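/- **Setting.** Let $P_0,\dots,P_3\in\mathbb R^3$ and let $p_0,\dots,p_3\in\mathbb R^3$ be points of the canvas $\{z=1\}$ with $p_i\cdot p_3\ne 0$ for all $i$. A *pose* for $(P,p)$ is a rigid motion (isometry) $T$ of $\mathbb R^3$ such that, for every $i$, $T(P_i)\neq 0$ and $T(P_i)$ lies on the ray from the origin through $p_i$. Let $S\subset(\mathbb R^3)^4\times(\mathbb R^3)^4$ be the set of all such $(P,p)$ that admit a pose. **The four-point algorithm.** For $i\in\{0,1,2\}$ let $j\equiv i+1$, $k\equiv i+2 \pmod 3$ be in $\{0,1,2\}$. 1. Compute $$a_i=\|P_j-P_k\|^2,\quad c_i=\|P_i-P_3\|^2,\quad b_i=\frac{(p_i\cdot p_i)(p_3\cdot p_3)}{(p_i\cdot p_3)^2},\quad d_i=\frac{(p_j\cdot p_k)(p_3\cdot p_3)}{(p_j\cdot p_3)(p_k\cdot p_3)}.$$ 2. Form the quadratics $Q_i(x)=X_{i,2}x^2+X_{i,1}x+X_{i,0}$, $i=0,\dots,3$. Here $X_{0,m}$ and $X_{3,m}$ are explicit integer polynomials in the $a$'s, $b$'s, $c$'s, $d$'s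 (the ones written out in full as `coeffX00`, …, `coeffX32` in the accompanying formal definitions), and $X_{1,m}$, resp. $X_{2,m}$, is obtained from $X_{0,m}$ by exchanging the indices $0$ and $1$, resp. $0$ and $2$, in all variables. 3. Form the 16 quadruples $(\alpha_0,\dots,\alpha_3)$ with $\alpha_i$ a (complex) root of $Q_i$. 4. For each, let $z_3=\sqrt{\alpha_3}$ and $z_i=\pm\sqrt{\alpha_i}$ for $i<3$ (principal square roots), with the sign of $p_i\cdot p_3$. 5. Among these quadruples $(z_0,\dots,z_3)$ choose one that minimizes the error in the six equations $$a_i=b_jz_j^2+b_kz_k^2-2d_iz_jz_k,\qquad c_i=z_3^2+b_iz_i^2-2z_iz_3\qquad(i=0,1,2).$$ The error may be any fixed real-valued function of the six differences of the two sides that is $0$ when all of them vanish and positive otherwise. 6. Return $\zeta_i=\dfrac{\|p_3\|}{p_i\cdot p_3}\,z_i$ for $i=0,\dots,3$. **Claim.** For general $(P,p)\in S$ the algorithm returns exactly the depths. That is, there is a real polynomial $F$ in the coordinates of the $P_i$ and $p_i$ such that $\{(P,p)\in S: F(P,p)\neq0\}$ is dense in $S$ and such that the following holds for every $(P,p)\in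 S$ with $F(P,p)\ne0$, every pose $T$ for $(P,p)$, and every choice of error function: there are real numbers $z_i>0$ with $T(P_i)=z_ip_i$ for all $i$, every $Q_i$ has degree exactly $2$, and the algorithm, run in exact arithmetic on $(P,p)$, has $(z_0,z_1,z_2,z_3)$ as its one and only possible output. -/

import Mathlib

namespace FourPoint

/-- Euclidean three-space. -/
abbrev Space : Type := EuclideanSpace ℝ (Fin 3)

/-! ### The explicit coefficients of the quadratics `Q_0` and `Q_3` -/

/-- Coefficient of `x ^ 0` in `Q_0`. -/
def coeffX00 {R : Type*} [CommRing R] (a0 a1 a2 _b0 b1 b2 c0 c1 _c2 d0 d1 d2 : R) : R :=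
    c0^2*a0*b1*d0*d1 - 2*c0*c1*a0*b1*d0*d1 + c1^2*a0*b1*d0*d1 + c0^2*a1*b1*d0*d1
    - 2*c0*c1*a1*b1*d0*d1 + c1^2*a1*b1*d0*d1 - c0^2*a2*b1*d0*d1 + 2*c0*c1*a2*b1*d0*d1
    - c1^2*a2*b1*d0*d1 + 2*c0*a0*a2*b1*d0*d1 - 2*c1*a0*a2*b1*d0*d1 + 2*c0*a1*a2*b1*d0*d1
    - 2*c1*a1*a2*b1*d0*d1 - 2*c0*a2^2*b1*d0*d1 + 2*c1*a2^2*b1*d0*d1 + a0*a2^2*b1*d0*d1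
    + a1*a2^2*b1*d0*d1 - a2^3*b1*d0*d1 - c0^2*a0*b1*b2*d2 + 2*c0*c1*a0*b1*b2*d2 - c1^2*a0*b1*b2*d2
    - c0*a0^2*b1*b2*d2 + c1*a0^2*b1*b2*d2 + c0^2*a1*b1*b2*d2 - 2*c0*c1*a1*b1*b2*d2
    + c1^2*a1*b1*b2*d2 + 2*c0*a0*a1*b1*b2*d2 - 2*c1*a0*a1*b1*b2*d2 - c0*a1^2*b1*b2*d2
    + c1*a1^2*b1*b2*d2 + c0^2*a2*b1*b2*d2 - 2*c0*c1*a2*b1*b2*d2 + c1^2*a2*b1*b2*d2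
    - a0^2*a2*b1*b2*d2 + 2*a0*a1*a2*b1*b2*d2 - a1^2*a2*b1*b2*d2 + c0*a2^2*b1*b2*d2
    - c1*a2^2*b1*b2*d2 + a0*a2^2*b1*b2*d2 - a1*a2^2*b1*b2*d2 - 2*c0^2*a1*d0^2*d2
    + 4*c0*c1*a1*d0^2*d2 - 2*c1^2*a1*d0^2*d2 + 2*a1*a2^2*d0^2*d2 - c0*a0^2*b1*b2 - c1*a0^2*b1*b2
    + 2*c0*a0*a1*b1*b2 + 2*c1*a0*a1*b1*b2 - c0*a1^2*b1*b2 - c1*a1^2*b1*b2 + 2*c0*a0*a2*b1*b2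
    + 2*c1*a0*a2*b1*b2 + a0^2*a2*b1*b2 - 2*c0*a1*a2*b1*b2 - 2*c1*a1*a2*b1*b2 - 2*a0*a1*a2*b1*b2
    + a1^2*a2*b1*b2 - c0*a2^2*b1*b2 - c1*a2^2*b1*b2 - 2*a0*a2^2*b1*b2 + 2*a1*a2^2*b1*b2
    + a2^3*b1*b2 + 4*c0*a1*a2*d0^2 + 4*c1*a1*a2*d0^2 - 4*a1*a2^2*d0^2 - 4*c0*a0*a2*d0*d1
    - 4*c0*a1*a2*d0*d1 + 4*c0*a2^2*d0*d1 + 2*c0*a0^2*b2*d2 - 4*c0*a0*a1*b2*d2 + 2*c0*a1^2*b2*d2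
    - 2*c0*a2^2*b2*d2

/-- Coefficient of `x ^ 1` in `Q_0`. -/
def coeffX01 {R : Type*} [CommRing R] (a0 a1 a2 b0 b1 b2 c0 c1 _c2 d0 d1 d2 : R) : R :=
    -4*c0*a0*b0*b1*d0*d1 + 4*c1*a0*b0*b1*d0*d1 - 4*c0*a1*b0*b1*d0*d1 + 4*c1*a1*b0*b1*d0*d1
    + 4*c0*a2*b0*b1*d0*d1 - 4*c1*a2*b0*b1*d0*d1 - 4*a0*a2*b0*b1*d0*d1 - 4*a1*a2*b0*b1*d0*d1
    + 4*a2^2*b0*b1*d0*d1 - 2*c0^2*b0*b1*b2*d2 + 4*c0*c1*b0*b1*b2*d2 - 2*c1^2*b0*b1*b2*d2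
    + 2*a0^2*b0*b1*b2*d2 - 4*a0*a1*b0*b1*b2*d2 + 2*a1^2*b0*b1*b2*d2 - 4*c0*a2*b0*b1*b2*d2
    + 4*c1*a2*b0*b1*b2*d2 - 4*a0*a2*b0*b1*b2*d2 + 4*a1*a2*b0*b1*b2*d2 + 2*c0^2*b0*d0^2*d2
    - 4*c0*c1*b0*d0^2*d2 + 2*c1^2*b0*d0^2*d2 + 4*c0*a1*b0*d0^2*d2 - 4*c1*a1*b0*d0^2*d2
    - 4*a1*a2*b0*d0^2*d2 - 2*a2^2*b0*d0^2*d2 + 2*c0^2*b1*d1^2*d2 - 4*c0*c1*b1*d1^2*d2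
    + 2*c1^2*b1*d1^2*d2 + 4*c0*a0*b1*d1^2*d2 - 4*c1*a0*b1*d1^2*d2 + 4*a0*a2*b1*d1^2*d2
    - 2*a2^2*b1*d1^2*d2 - 4*c0^2*d0*d1*d2^2 + 8*c0*c1*d0*d1*d2^2 - 4*c1^2*d0*d1*d2^2
    + 4*a0*a2*d0*d1*d2^2 + 4*a1*a2*d0*d1*d2^2 + 2*c0^2*b2*d2^3 - 4*c0*c1*b2*d2^3 + 2*c1^2*b2*d2^3
    - 2*a0^2*b2*d2^3 + 4*a0*a1*b2*d2^3 - 2*a1^2*b2*d2^3 - 4*c0*a0*b0*b1*b2 - 4*c1*a0*b0*b1*b2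
    + 4*c0*a1*b0*b1*b2 + 4*c1*a1*b0*b1*b2 + 4*c0*a2*b0*b1*b2 + 4*c1*a2*b0*b1*b2 + 4*a0*a2*b0*b1*b2
    - 4*a1*a2*b0*b1*b2 - 4*a2^2*b0*b1*b2 - 4*c0*a1*b0*d0^2 - 4*c1*a1*b0*d0^2 - 4*c0*a2*b0*d0^2
    - 4*c1*a2*b0*d0^2 + 4*a1*a2*b0*d0^2 + 4*a2^2*b0*d0^2 + 4*c0*a0*b0*d0*d1 + 4*c0*a1*b0*d0*d1
    - 4*c0*a2*b0*d0*d1 + 4*a0*a2*b0*d0*d1 + 4*a1*a2*b0*d0*d1 - 4*a2^2*b0*d0*d1 - 4*c1*a0*b1*d0*d1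
    - 4*c1*a1*b1*d0*d1 + 4*c1*a2*b1*d0*d1 + 4*a0*a2*b1*d0*d1 + 4*a1*a2*b1*d0*d1 - 4*a2^2*b1*d0*d1
    + 4*c0*a0*b1*d1^2 + 4*c1*a0*b1*d1^2 - 4*c0*a2*b1*d1^2 - 4*c1*a2*b1*d1^2 - 4*a0*a2*b1*d1^2
    + 4*a2^2*b1*d1^2 + 4*c0*a0*b0*b2*d2 - 2*a0^2*b0*b2*d2 - 4*c0*a1*b0*b2*d2 + 4*a0*a1*b0*b2*d2
    - 2*a1^2*b0*b2*d2 + 4*c0*a2*b0*b2*d2 + 2*a2^2*b0*b2*d2 + 4*c1*a0*b1*b2*d2 - 2*a0^2*b1*b2*d2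
    - 4*c1*a1*b1*b2*d2 + 4*a0*a1*b1*b2*d2 - 2*a1^2*b1*b2*d2 - 4*c1*a2*b1*b2*d2 + 2*a2^2*b1*b2*d2
    + 8*c1*a1*d0^2*d2 + 8*c0*a2*d0*d1*d2 + 8*c1*a2*d0*d1*d2 - 8*a0*a2*d0*d1*d2 - 8*a1*a2*d0*d1*d2
    - 8*c0*a0*d1^2*d2 + 4*a0^2*b2*d2^2 - 8*a0*a1*b2*d2^2 + 4*a1^2*b2*d2^2 - 4*c0*a2*b2*d2^2
    - 4*c1*a2*b2*d2^2

/-- Coefficient of `x ^ 2` in `Q_0`. -/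
def coeffX02 {R : Type*} [CommRing R] (a0 a1 a2 b0 b1 b2 c0 c1 _c2 d0 d1 d2 : R) : R :=
    4*a0*b0^2*b1*d0*d1 + 4*a1*b0^2*b1*d0*d1 - 4*a2*b0^2*b1*d0*d1 + 4*c0*b0^2*b1*b2*d2
    - 4*c1*b0^2*b1*b2*d2 + 4*a0*b0^2*b1*b2*d2 - 4*a1*b0^2*b1*b2*d2 - 4*c0*b0^2*d0^2*d2
    + 4*c1*b0^2*d0^2*d2 + 4*a2*b0^2*d0^2*d2 - 4*c0*b0*b1*d1^2*d2 + 4*c1*b0*b1*d1^2*d2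
    - 8*a0*b0*b1*d1^2*d2 + 4*a2*b0*b1*d1^2*d2 + 8*c0*b0*d0*d1*d2^2 - 8*c1*b0*d0*d1*d2^2
    - 4*a0*b0*d0*d1*d2^2 - 4*a1*b0*d0*d1*d2^2 - 4*a2*b0*d0*d1*d2^2 - 4*c0*b0*b2*d2^3
    + 4*c1*b0*b2*d2^3 - 4*a0*b0*b2*d2^3 + 4*a1*b0*b2*d2^3 + 8*a0*d1^2*d2^3 - 4*c0*b0^2*b1*b2
    - 4*c1*b0^2*b1*b2 + 4*a2*b0^2*b1*b2 + 4*c0*b0^2*d0^2 + 4*c1*b0^2*d0^2 - 4*a2*b0^2*d0^2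
    - 4*a0*b0^2*d0*d1 - 4*a1*b0^2*d0*d1 + 4*a2*b0^2*d0*d1 - 4*a0*b0*b1*d0*d1 - 4*a1*b0*b1*d0*d1
    + 4*a2*b0*b1*d0*d1 + 4*c0*b0*b1*d1^2 + 4*c1*b0*b1*d1^2 - 4*a2*b0*b1*d1^2 - 4*a0*b0^2*b2*d2
    + 4*a1*b0^2*b2*d2 - 4*a2*b0^2*b2*d2 + 8*c1*b0*b1*b2*d2 - 4*a0*b0*b1*b2*d2 + 4*a1*b0*b1*b2*d2
    - 4*a2*b0*b1*b2*d2 - 8*c1*b0*d0^2*d2 - 8*c0*b0*d0*d1*d2 - 8*c1*b0*d0*d1*d2 + 8*a0*b0*d0*d1*d2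
    + 8*a1*b0*d0*d1*d2 + 8*a0*b0*d1^2*d2 - 8*c1*b1*d1^2*d2 + 8*a0*b1*d1^2*d2 + 4*c0*b0*b2*d2^2
    + 4*c1*b0*b2*d2^2 + 8*a0*b0*b2*d2^2 - 8*a1*b0*b2*d2^2 + 4*a2*b0*b2*d2^2 + 16*c1*d0*d1*d2^2
    - 16*a0*d1^2*d2^2 - 8*c1*b2*d2^3

/-- Coefficient of `x ^ 0` in `Q_3`. -/
def coeffX30 {R : Type*} [CommRing R] (_a0 a1 a2 b0 b1 b2 c0 c1 c2 _d0 d1 d2 : R) : R :=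
    c0^2*c1*b0*b1*b2 + c0*c1^2*b0*b1*b2 - c0^2*c2*b0*b1*b2 + c1^2*c2*b0*b1*b2 - c0*c2^2*b0*b1*b2
    - c1*c2^2*b0*b1*b2 + c0^2*a1*b0*b1*b2 - c1^2*a1*b0*b1*b2 + 2*c0*c2*a1*b0*b1*b2
    + 2*c1*c2*a1*b0*b1*b2 - c0*a1^2*b0*b1*b2 - c1*a1^2*b0*b1*b2 - c0^2*a2*b0*b1*b2
    - 2*c0*c1*a2*b0*b1*b2 - 2*c1*c2*a2*b0*b1*b2 + c2^2*a2*b0*b1*b2 + 2*c1*a1*a2*b0*b1*b2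
    - 2*c2*a1*a2*b0*b1*b2 + a1^2*a2*b0*b1*b2 + c0*a2^2*b0*b1*b2 + c2*a2^2*b0*b1*b2
    - a1*a2^2*b0*b1*b2 - c0^3*b0*b1*d1 - 2*c0^2*c1*b0*b1*d1 - c0*c1^2*b0*b1*d1 + c0^2*c2*b0*b1*d1
    + 2*c0*c1*c2*b0*b1*d1 + c1^2*c2*b0*b1*d1 + c0^2*a1*b0*b1*d1 + 2*c0*c1*a1*b0*b1*d1
    + c1^2*a1*b0*b1*d1 + 2*c0^2*a2*b0*b1*d1 + 2*c0*c1*a2*b0*b1*d1 - 2*c0*c2*a2*b0*b1*d1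
    - 2*c1*c2*a2*b0*b1*d1 - 2*c0*a1*a2*b0*b1*d1 - 2*c1*a1*a2*b0*b1*d1 - c0*a2^2*b0*b1*d1
    + c2*a2^2*b0*b1*d1 + a1*a2^2*b0*b1*d1 + 2*c0^2*c2*b1*d1^2 - 2*c1^2*c2*b1*d1^2
    + 4*c1*c2*a2*b1*d1^2 - 2*c2*a2^2*b1*d1^2 + c0^3*b0*b2*d2 - c0^2*c1*b0*b2*d2
    + 2*c0^2*c2*b0*b2*d2 - 2*c0*c1*c2*b0*b2*d2 + c0*c2^2*b0*b2*d2 - c1*c2^2*b0*b2*d2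
    - 2*c0^2*a1*b0*b2*d2 + 2*c0*c1*a1*b0*b2*d2 - 2*c0*c2*a1*b0*b2*d2 + 2*c1*c2*a1*b0*b2*d2
    + c0*a1^2*b0*b2*d2 - c1*a1^2*b0*b2*d2 - c0^2*a2*b0*b2*d2 - 2*c0*c2*a2*b0*b2*d2
    - c2^2*a2*b0*b2*d2 + 2*c0*a1*a2*b0*b2*d2 + 2*c2*a1*a2*b0*b2*d2 - a1^2*a2*b0*b2*d2
    - 4*c0^2*c2*d1^2*d2 + 4*c0*c1*c2*d1^2*d2 + 4*c0*c2*a2*d1^2*d2 - 2*c0^2*c1*b2*d2^2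
    + 2*c1*c2^2*b2*d2^2 - 4*c1*c2*a1*b2*d2^2 + 2*c1*a1^2*b2*d2^2 + 4*c0^2*c1*d1*d2^2
    - 4*c0*c1*c2*d1*d2^2 - 4*c0*c1*a1*d1*d2^2

/-- Coefficient of `x ^ 1` in `Q_3`. -/
def coeffX31 {R : Type*} [CommRing R] (_a0 a1 a2 b0 b1 b2 c0 c1 c2 _d0 d1 d2 : R) : R :=
    -4*c0*c1*b0*b1*b2 - 2*c1^2*b0*b1*b2 + 4*c0*c2*b0*b1*b2 + 2*c2^2*b0*b1*b2 - 4*c0*a1*b0*b1*b2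
    - 4*c2*a1*b0*b1*b2 + 2*a1^2*b0*b1*b2 + 4*c0*a2*b0*b1*b2 + 4*c1*a2*b0*b1*b2 - 2*a2^2*b0*b1*b2
    + 4*c0^2*b0*b1*d1 + 4*c0*c1*b0*b1*d1 - 4*c0*c2*b0*b1*d1 - 4*c1*c2*b0*b1*d1 - 4*c0*a1*b0*b1*d1
    - 4*c1*a1*b0*b1*d1 - 4*c0*a2*b0*b1*d1 + 4*c2*a2*b0*b1*d1 + 4*a1*a2*b0*b1*d1 - 2*c0^2*b1*d1^2
    + 2*c1^2*b1*d1^2 - 4*c0*c2*b1*d1^2 + 4*c1*c2*b1*d1^2 - 4*c1*a2*b1*d1^2 - 4*c2*a2*b1*d1^2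
    + 2*a2^2*b1*d1^2 - 4*c0^2*b0*b2*d2 + 4*c0*c1*b0*b2*d2 - 4*c0*c2*b0*b2*d2 + 4*c1*c2*b0*b2*d2
    + 4*c0*a1*b0*b2*d2 - 4*c1*a1*b0*b2*d2 + 4*c0*a2*b0*b2*d2 + 4*c2*a2*b0*b2*d2 - 4*a1*a2*b0*b2*d2
    + 4*c0^2*d1^2*d2 - 4*c0*c1*d1^2*d2 + 4*c0*c2*d1^2*d2 - 4*c1*c2*d1^2*d2 - 4*c0*a2*d1^2*d2
    - 4*c2*a2*d1^2*d2 + 2*c0^2*b2*d2^2 + 4*c0*c1*b2*d2^2 - 4*c1*c2*b2*d2^2 - 2*c2^2*b2*d2^2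
    + 4*c1*a1*b2*d2^2 + 4*c2*a1*b2*d2^2 - 2*a1^2*b2*d2^2 - 4*c0^2*d1*d2^2 - 4*c0*c1*d1*d2^2
    + 4*c0*c2*d1*d2^2 + 4*c1*c2*d1*d2^2 + 4*c0*a1*d1*d2^2 + 4*c1*a1*d1*d2^2 - 2*c0^2*b0*b1
    + 2*c1^2*b0*b1 + 4*c0*a1*b0*b1 + 4*c1*a1*b0*b1 - 4*c1*a2*b0*b1 - 4*a1*a2*b0*b1 + 2*a2^2*b0*b1
    + 2*c0^2*b0*b2 - 2*c2^2*b0*b2 + 4*c2*a1*b0*b2 - 2*a1^2*b0*b2 - 4*c0*a2*b0*b2 - 4*c2*a2*b0*b2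
    + 4*a1*a2*b0*b2 + 2*c1^2*b1*b2 - 2*c2^2*b1*b2 + 4*c2*a1*b1*b2 - 2*a1^2*b1*b2 - 4*c1*a2*b1*b2
    + 2*a2^2*b1*b2 - 4*c0^2*b0*d1 + 4*c0*c2*b0*d1 + 4*c0*a1*b0*d1 + 4*c0*a2*b0*d1 - 4*c2*a2*b0*d1
    - 4*a1*a2*b0*d1 - 4*c1^2*b1*d1 + 4*c0*c2*b1*d1 + 4*c0*a1*b1*d1 + 8*c1*a2*b1*d1 - 4*a2^2*b1*d1
    + 8*c2*a2*d1^2 + 4*c0^2*b0*d2 - 4*c0*c1*b0*d2 - 4*c0*a1*b0*d2 + 4*c1*a1*b0*d2 - 4*c0*a2*b0*d2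
    + 4*a1*a2*b0*d2 - 4*c0*c1*b2*d2 + 4*c2^2*b2*d2 - 8*c2*a1*b2*d2 + 4*a1^2*b2*d2 - 4*c0*a2*b2*d2
    + 8*c0*c1*d1*d2 - 8*c0*c2*d1*d2 - 8*c0*a1*d1*d2 + 8*c0*a2*d1*d2 - 8*c1*a1*d2^2

/-- Coefficient of `x ^ 2` in `Q_3`. -/
def coeffX32 {R : Type*} [CommRing R] (_a0 a1 a2 b0 b1 b2 c0 c1 c2 _d0 d1 d2 : R) : R :=
    4*c1*b0*b1*b2 - 4*c2*b0*b1*b2 + 4*a1*b0*b1*b2 - 4*a2*b0*b1*b2 - 4*c0*b0*b1*d1 + 4*c2*b0*b1*d1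
    + 4*a1*b0*b1*d1 + 4*c0*b1*d1^2 - 4*c1*b1*d1^2 + 4*a2*b1*d1^2 + 4*c0*b0*b2*d2 - 4*c1*b0*b2*d2
    - 4*a2*b0*b2*d2 - 4*c0*d1^2*d2 + 4*c1*d1^2*d2 + 4*a2*d1^2*d2 - 4*c0*b2*d2^2 + 4*c2*b2*d2^2
    - 4*a1*b2*d2^2 + 4*c0*d1*d2^2 - 4*c2*d1*d2^2 - 4*a1*d1*d2^2 + 4*c0*b0*b1 - 4*c1*b0*b1
    - 8*a1*b0*b1 + 4*a2*b0*b1 - 4*c0*b0*b2 + 4*c2*b0*b2 - 4*a1*b0*b2 + 8*a2*b0*b2 - 4*c1*b1*b2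
    + 4*c2*b1*b2 - 4*a1*b1*b2 + 4*a2*b1*b2 + 4*c0*b0*d1 - 4*c2*b0*d1 - 4*a1*b0*d1 - 4*c0*b1*d1
    + 8*c1*b1*d1 - 4*c2*b1*d1 - 4*a1*b1*d1 - 8*a2*b1*d1 - 8*a2*d1^2 - 4*c0*b0*d2 + 4*c1*b0*d2
    + 4*a2*b0*d2 + 4*c0*b2*d2 + 4*c1*b2*d2 - 8*c2*b2*d2 + 8*a1*b2*d2 + 4*a2*b2*d2 - 8*c1*d1*d2
    + 8*c2*d1*d2 + 8*a1*d1*d2 - 8*a2*d1*d2 + 8*a1*d2^2 + 8*a1*b0 - 8*a2*b0 + 8*a1*b1 - 8*a2*b2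
    + 16*a2*d1 - 16*a1*d2

/-- The coefficients `X_{i,j}` of `Q_i(x) = X_{i,2} x² + X_{i,1} x + X_{i,0}`, as functions of
`a, b, c, d`.  Those of `Q_1`, `Q_2` are obtained from those of `Q_0` by exchanging the indices
`0` and `1`, resp. `0` and `2`, in all the variables. -/
def coeffX {R : Type*} [CommRing R] (a b c d : Fin 3 → R) (i : Fin 4) (j : Fin 3) : R :=
  let X0 (σ : Equiv.Perm (Fin 3)) : Fin 3 → R :=
    ![coeffX00 (a (σ 0)) (a (σ 1)) (a (σ 2)) (b (σ 0)) (b (σ 1)) (b (σ 2))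
        (c (σ 0)) (c (σ 1)) (c (σ 2)) (d (σ 0)) (d (σ 1)) (d (σ 2)),
      coeffX01 (a (σ 0)) (a (σ 1)) (a (σ 2)) (b (σ 0)) (b (σ 1)) (b (σ 2))
        (c (σ 0)) (c (σ 1)) (c (σ 2)) (d (σ 0)) (d (σ 1)) (d (σ 2)),
      coeffX02 (a (σ 0)) (a (σ 1)) (a (σ 2)) (b (σ 0)) (b (σ 1)) (b (σ 2))
        (c (σ 0)) (c (σ 1)) (c (σ 2)) (d (σ 0)) (d (σ 1)) (d (σ 2))]
  let X3 : Fin 3 → R :=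
    ![coeffX30 (a 0) (a 1) (a 2) (b 0) (b 1) (b 2) (c 0) (c 1) (c 2) (d 0) (d 1) (d 2),
      coeffX31 (a 0) (a 1) (a 2) (b 0) (b 1) (b 2) (c 0) (c 1) (c 2) (d 0) (d 1) (d 2),
      coeffX32 (a 0) (a 1) (a 2) (b 0) (b 1) (b 2) (c 0) (c 1) (c 2) (d 0) (d 1) (d 2)]
  (![X0 1, X0 (Equiv.swap 0 1), X0 (Equiv.swap 0 2), X3] : Fin 4 → Fin 3 → R) i j

/-! ### Distances and dot products

The indices `0, 1, 2` of the first three points are `i.castSucc` for `i : Fin 3`; addition in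
`Fin 3` is modulo `3`, so that `j = i + 1` and `k = i + 2` is the cyclic indexing. -/

/-- `a_i = ‖P_j - P_k‖²`. -/
noncomputable def coordA (P : Fin 4 → Space) (i : Fin 3) : ℝ :=
  ‖P (i + 1).castSucc - P (i + 2).castSucc‖ ^ 2

/-- `c_i = ‖P_i - P_3‖²`. -/
noncomputable def coordC (P : Fin 4 → Space) (i : Fin 3) : ℝ :=
  ‖P i.castSucc - P 3‖ ^ 2

/-- `b_i = (p_i · p_i)(p_3 · p_3) / (p_i · p_3)²`. -/
noncomputable def coordB (p : Fin 4 → Space) (i : Fin 3) : ℝ :=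
  inner ℝ (p i.castSucc) (p i.castSucc) * inner ℝ (p 3) (p 3)
    / inner ℝ (p i.castSucc) (p 3) ^ 2

/-- `d_i = (p_j · p_k)(p_3 · p_3) / ((p_j · p_3)(p_k · p_3))`. -/
noncomputable def coordD (p : Fin 4 → Space) (i : Fin 3) : ℝ :=
  inner ℝ (p (i + 1).castSucc) (p (i + 2).castSucc) * inner ℝ (p 3) (p 3)
    / (inner ℝ (p (i + 1).castSucc) (p 3) * inner ℝ (p (i + 2).castSucc) (p 3))

/-! ### The algorithm -/

open Polynomial in
/-- The quadratic `Q_i` computed from the input `(P, p)`.  It has real coefficients; it is regarded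
as a complex polynomial so that its two roots are always available. -/
noncomputable def quadQ (P p : Fin 4 → Space) (i : Fin 4) : ℂ[X] :=
  let x (j : Fin 3) : ℂ := (coeffX (coordA P) (coordB p) (coordC P) (coordD p) i j : ℝ)
  C (x 2) * X ^ 2 + C (x 1) * X + C (x 0)

/-- The candidate depths attached to a quadruple `α` of roots: `z_i = ±√α_i` (principal square
root), the sign being that of `p_i · p_3`; in particular `z_3 = √α_3`. -/
noncomputable def candidate (p : Fin 4 → Space) (α : Fin 4 → ℂ) (i : Fin 4) : ℂ :=
  if 0 < inner ℝ (p i) (p 3) then (α i).sqrt else -(α i).sqrt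

/-- The vector of the six errors of the depths `z` in the equations
`a_i = b_j z_j² + b_k z_k² - 2 d_i z_j z_k` (first three entries) and
`c_i = z_3² + b_i z_i² - 2 z_i z_3` (last three entries). -/
noncomputable def residual (P p : Fin 4 → Space) (z : Fin 4 → ℂ) : Fin 3 ⊕ Fin 3 → ℂ :=
  Sum.elim
    (fun i => (coordA P i : ℂ) -
      (coordB p (i + 1) * z (i + 1).castSucc ^ 2 + coordB p (i + 2) * z (i + 2).castSucc ^ 2
        - 2 * coordD p i * z (i + 1).castSucc * z (i + 2).castSucc))
    (fun i => (coordC P i : ℂ) -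
      (z 3 ^ 2 + coordB p i * z i.castSucc ^ 2 - 2 * z i.castSucc * z 3))

/-- A way to measure the size of the six errors: a real function of the error vector that is zero
at the zero vector and positive elsewhere (such as a norm or the sum of the squared absolute
values). -/
structure IsErrorMeasure (err : (Fin 3 ⊕ Fin 3 → ℂ) → ℝ) : Prop where
  zero : err 0 = 0
  pos : ∀ r, r ≠ 0 → 0 < err r

/-- `IsOutput err P p ζ`: run on the matched quadruple `(P, p)`, with errors measured by `err`, the
four-point algorithm can return the depths `ζ`.  That is, the four `Q_i` are genuinely quadratic,
so that they yield the sixteen quadruples of roots, and `ζ` is obtained by rescaling the candidate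
of a quadruple of roots whose error is minimal among all the quadruples of roots. -/
def IsOutput (err : (Fin 3 ⊕ Fin 3 → ℂ) → ℝ) (P p : Fin 4 → Space) (ζ : Fin 4 → ℂ) : Prop :=
  (∀ i, (quadQ P p i).natDegree = 2) ∧
  ∃ α : Fin 4 → ℂ, (∀ i, (quadQ P p i).IsRoot (α i)) ∧
    (∀ β : Fin 4 → ℂ, (∀ i, (quadQ P p i).IsRoot (β i)) →
      err (residual P p (candidate p α)) ≤ err (residual P p (candidate p β))) ∧
    ∀ i, ζ i = ((‖p 3‖ / inner ℝ (p i) (p 3) : ℝ) : ℂ) * candidate p α i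

/-! ### Perspective configurations and genericity -/

/-- The rigid motion `T` is a pose for `(P, p)`: each `T (P_i)` is nonzero and lies on the ray from
the origin through `p_i`. -/
def IsPose (P p : Fin 4 → Space) (T : Space ≃ᵃⁱ[ℝ] Space) : Prop :=
  ∀ i, T (P i) ≠ 0 ∧ ∃ t : ℝ, 0 ≤ t ∧ T (P i) = t • p i

/-- The set of matched quadruples `(P, p)` coming from the perspective problem: the `p_i` are
points of the canvas `z = 1`, none of them orthogonal to `p_3`, and there is a pose. -/
def perspectiveSet : Set ((Fin 4 → Space) × (Fin 4 → Space)) :=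
  {x | (∀ i, x.2 i 2 = 1) ∧ (∀ i, inner ℝ (x.2 i) (x.2 3) ≠ 0) ∧ ∃ T, IsPose x.1 x.2 T}

/-- The value of a polynomial in the coordinates of the eight points of `(P, p)`. -/
noncomputable def evalConfig (F : MvPolynomial (Fin 4 × Fin 3 ⊕ Fin 4 × Fin 3) ℝ)
    (x : (Fin 4 → Space) × (Fin 4 → Space)) : ℝ :=
  MvPolynomial.eval (Sum.elim (fun q => x.1 q.1 q.2) (fun q => x.2 q.1 q.2)) F

end FourPoint

/-!
Let `T` be a pose with `T (P_i) = t_i p_i`, and put `Z_i = t_i (p_i · p_3) / ‖p_3‖`.  By the law of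
cosines the `Z_i` solve the six equations exactly (`isDepthSolution_of_pose`).  Conversely, an
output of the algorithm comes from a candidate of minimal error, and the minimum is `0` because the
squares `Z_i²` are roots of the `Q_i`; so everything reduces to showing that, for general data, the
six equations have no complex solutions other than `Z` and `-Z`.  The rule that `z_3` is a principal
square root then excludes `-Z`.

For every solution `z` of the six equations, over any commutative ring, `Q_i (z_i²) = 0`.  This is
an identity in the `z_i`, `b_i`, `d_i` (`coeffX0_root`, `coeffX3_root`); it does not use that the
four vectors `p_i` are linearly dependent.  The six equations are symmetric under relabelling the
first three points, but the `Q_i` are not: a suitable transposition produces a second quadratic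
with the root `z_i²` that in general is not proportional to `Q_i`.  Eliminating `x²` between the two
leaves a linear equation, so `z_i²` is determined by `a, b, c, d` wherever its leading coefficient
`eliminant` is nonzero (`IsDepthSolution.sq_eq_sq`).  The equations for the `c_i` then determine the
products `z_i z_3`, hence `z` up to a common sign (`IsDepthSolution.eq_or_eq_neg`).

The polynomial `F` is a numerator of the product of all the leading coefficients of the `Q_i` and
all the eliminants, a rational function whose denominators involve only the `p_i · p_3`.  Since this
product depends on `P` only through distances, it can be evaluated on any configuration by
forgetting the pose.  For density, keep the pose of a given configuration fixed and move the canvas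
points and the depths along segments towards an integral configuration where `F` does not vanish.
Along this path `F` is a nonzero polynomial in one variable, so it has only finitely many zeros.
-/

namespace FourPoint

/-! ### The algebra of the six equations -/

section Algebra

variable {R S : Type*} [CommRing R] [CommRing S]

/-- The six equations of the algorithm: `z` is an exact solution of
`a_i = b_j z_j² + b_k z_k² - 2 d_i z_j z_k` and `c_i = z_3² + b_i z_i² - 2 z_i z_3`. -/
def IsDepthSolution (a b c d : Fin 3 → R) (z : Fin 4 → R) : Prop :=
  (∀ i : Fin 3, a i = b (i + 1) * z (i + 1).castSucc ^ 2 + b (i + 2) * z (i + 2).castSucc ^ 2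
    - 2 * d i * z (i + 1).castSucc * z (i + 2).castSucc) ∧
  ∀ i : Fin 3, c i = z 3 ^ 2 + b i * z i.castSucc ^ 2 - 2 * z i.castSucc * z 3

/-- In every solution of the six equations, `z_0²` is a root of `Q_0`. -/
theorem coeffX0_root {a0 a1 a2 b0 b1 b2 c0 c1 c2 d0 d1 d2 z0 z1 z2 z3 : R}
    (ha0 : a0 = b1 * z1 ^ 2 + b2 * z2 ^ 2 - 2 * d0 * z1 * z2)
    (ha1 : a1 = b2 * z2 ^ 2 + b0 * z0 ^ 2 - 2 * d1 * z2 * z0)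
    (ha2 : a2 = b0 * z0 ^ 2 + b1 * z1 ^ 2 - 2 * d2 * z0 * z1)
    (hc0 : c0 = z3 ^ 2 + b0 * z0 ^ 2 - 2 * z0 * z3)
    (hc1 : c1 = z3 ^ 2 + b1 * z1 ^ 2 - 2 * z1 * z3) :
    coeffX02 a0 a1 a2 b0 b1 b2 c0 c1 c2 d0 d1 d2 * z0 ^ 4
      + coeffX01 a0 a1 a2 b0 b1 b2 c0 c1 c2 d0 d1 d2 * z0 ^ 2
      + coeffX00 a0 a1 a2 b0 b1 b2 c0 c1 c2 d0 d1 d2 = 0 := by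
  subst ha0 ha1 ha2 hc0 hc1
  simp only [coeffX00, coeffX01, coeffX02]
  ring

/-- In every solution of the six equations, `z_3²` is a root of `Q_3`. -/
theorem coeffX3_root {a0 a1 a2 b0 b1 b2 c0 c1 c2 d0 d1 d2 z0 z1 z2 z3 : R}
    (ha1 : a1 = b2 * z2 ^ 2 + b0 * z0 ^ 2 - 2 * d1 * z2 * z0)
    (ha2 : a2 = b0 * z0 ^ 2 + b1 * z1 ^ 2 - 2 * d2 * z0 * z1)
    (hc0 : c0 = z3 ^ 2 + b0 * z0 ^ 2 - 2 * z0 * z3)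
    (hc1 : c1 = z3 ^ 2 + b1 * z1 ^ 2 - 2 * z1 * z3)
    (hc2 : c2 = z3 ^ 2 + b2 * z2 ^ 2 - 2 * z2 * z3) :
    coeffX32 a0 a1 a2 b0 b1 b2 c0 c1 c2 d0 d1 d2 * z3 ^ 4
      + coeffX31 a0 a1 a2 b0 b1 b2 c0 c1 c2 d0 d1 d2 * z3 ^ 2
      + coeffX30 a0 a1 a2 b0 b1 b2 c0 c1 c2 d0 d1 d2 = 0 := by
  subst ha1 ha2 hc0 hc1 hc2
  simp only [coeffX30, coeffX31, coeffX32]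
  ring

theorem map_coeffX00 (φ : R →+* S) (a0 a1 a2 b0 b1 b2 c0 c1 c2 d0 d1 d2 : R) :
    φ (coeffX00 a0 a1 a2 b0 b1 b2 c0 c1 c2 d0 d1 d2)
      = coeffX00 (φ a0) (φ a1) (φ a2) (φ b0) (φ b1) (φ b2)
        (φ c0) (φ c1) (φ c2) (φ d0) (φ d1) (φ d2) := by
  simp only [coeffX00, map_add, map_sub, map_mul, map_pow, map_ofNat]

theorem map_coeffX01 (φ : R →+* S) (a0 a1 a2 b0 b1 b2 c0 c1 c2 d0 d1 d2 : R) :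
    φ (coeffX01 a0 a1 a2 b0 b1 b2 c0 c1 c2 d0 d1 d2)
      = coeffX01 (φ a0) (φ a1) (φ a2) (φ b0) (φ b1) (φ b2)
        (φ c0) (φ c1) (φ c2) (φ d0) (φ d1) (φ d2) := by
  simp only [coeffX01, map_add, map_sub, map_neg, map_mul, map_pow, map_ofNat]

theorem map_coeffX02 (φ : R →+* S) (a0 a1 a2 b0 b1 b2 c0 c1 c2 d0 d1 d2 : R) :
    φ (coeffX02 a0 a1 a2 b0 b1 b2 c0 c1 c2 d0 d1 d2)
      = coeffX02 (φ a0) (φ a1) (φ a2) (φ b0) (φ b1) (φ b2)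
        (φ c0) (φ c1) (φ c2) (φ d0) (φ d1) (φ d2) := by
  simp only [coeffX02, map_add, map_sub, map_mul, map_pow, map_ofNat]

theorem map_coeffX30 (φ : R →+* S) (a0 a1 a2 b0 b1 b2 c0 c1 c2 d0 d1 d2 : R) :
    φ (coeffX30 a0 a1 a2 b0 b1 b2 c0 c1 c2 d0 d1 d2)
      = coeffX30 (φ a0) (φ a1) (φ a2) (φ b0) (φ b1) (φ b2)
        (φ c0) (φ c1) (φ c2) (φ d0) (φ d1) (φ d2) := by
  simp only [coeffX30, map_add, map_sub, map_mul, map_pow, map_ofNat]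

theorem map_coeffX31 (φ : R →+* S) (a0 a1 a2 b0 b1 b2 c0 c1 c2 d0 d1 d2 : R) :
    φ (coeffX31 a0 a1 a2 b0 b1 b2 c0 c1 c2 d0 d1 d2)
      = coeffX31 (φ a0) (φ a1) (φ a2) (φ b0) (φ b1) (φ b2)
        (φ c0) (φ c1) (φ c2) (φ d0) (φ d1) (φ d2) := by
  simp only [coeffX31, map_add, map_sub, map_neg, map_mul, map_pow, map_ofNat]

theorem map_coeffX32 (φ : R →+* S) (a0 a1 a2 b0 b1 b2 c0 c1 c2 d0 d1 d2 : R) :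
    φ (coeffX32 a0 a1 a2 b0 b1 b2 c0 c1 c2 d0 d1 d2)
      = coeffX32 (φ a0) (φ a1) (φ a2) (φ b0) (φ b1) (φ b2)
        (φ c0) (φ c1) (φ c2) (φ d0) (φ d1) (φ d2) := by
  simp only [coeffX32, map_add, map_sub, map_mul, map_pow, map_ofNat]

theorem map_coeffX (φ : R →+* S) (a b c d : Fin 3 → R) (i : Fin 4) (j : Fin 3) :
    φ (coeffX a b c d i j) = coeffX (φ ∘ a) (φ ∘ b) (φ ∘ c) (φ ∘ d) i j := by
  fin_cases i <;> fin_cases j <;>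
    simp [coeffX, map_coeffX00, map_coeffX01, map_coeffX02, map_coeffX30, map_coeffX31,
      map_coeffX32]

theorem isDepthSolution_iff {a b c d : Fin 3 → R} {z : Fin 4 → R} :
    IsDepthSolution a b c d z ↔
      (a 0 = b 1 * z 1 ^ 2 + b 2 * z 2 ^ 2 - 2 * d 0 * z 1 * z 2 ∧
        a 1 = b 2 * z 2 ^ 2 + b 0 * z 0 ^ 2 - 2 * d 1 * z 2 * z 0 ∧
        a 2 = b 0 * z 0 ^ 2 + b 1 * z 1 ^ 2 - 2 * d 2 * z 0 * z 1) ∧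
      c 0 = z 3 ^ 2 + b 0 * z 0 ^ 2 - 2 * z 0 * z 3 ∧
      c 1 = z 3 ^ 2 + b 1 * z 1 ^ 2 - 2 * z 1 * z 3 ∧
      c 2 = z 3 ^ 2 + b 2 * z 2 ^ 2 - 2 * z 2 * z 3 := by
  simp only [IsDepthSolution, Fin.forall_fin_succ]
  simp [show (1 : Fin 3) + 2 = 0 from rfl, show (2 : Fin 3) + 2 = 1 from rfl,
    show (1 : Fin 3) + 1 = 2 from rfl, show (2 : Fin 3) + 1 = 0 from rfl,
    show Fin.castSucc (2 : Fin 3) = 2 from rfl]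

theorem IsDepthSolution.swap {a b c d : Fin 3 → R} {z : Fin 4 → R}
    (h : IsDepthSolution a b c d z) (x y : Fin 3) :
    IsDepthSolution (a ∘ Equiv.swap x y) (b ∘ Equiv.swap x y) (c ∘ Equiv.swap x y)
      (d ∘ Equiv.swap x y) (z ∘ Equiv.swap x.castSucc y.castSucc) := by
  rw [isDepthSolution_iff] at h ⊢
  obtain ⟨⟨ha0, ha1, ha2⟩, hc0, hc1, hc2⟩ := h
  fin_cases x <;> fin_cases y <;>
    simp [Equiv.swap_apply_def, show Fin.castSucc (2 : Fin 3) = 2 from rfl, *] <;>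
    (refine ⟨?_, ?_, ?_⟩ <;> ring)

theorem IsDepthSolution.coeffX_root {a b c d : Fin 3 → R} {z : Fin 4 → R}
    (h : IsDepthSolution a b c d z) (i : Fin 4) :
    coeffX a b c d i 2 * z i ^ 4 + coeffX a b c d i 1 * z i ^ 2 + coeffX a b c d i 0 = 0 := by
  have key {a b c d : Fin 3 → R} {z : Fin 4 → R} (h : IsDepthSolution a b c d z) :=
    let ⟨⟨ha0, ha1, ha2⟩, hc0, hc1, _⟩ := isDepthSolution_iff.1 h
    coeffX0_root (c2 := c 2) ha0 ha1 ha2 hc0 hc1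
  fin_cases i
  · simpa [coeffX] using key h
  · simpa [coeffX, Equiv.swap_apply_def] using key (h.swap 0 1)
  · simpa [coeffX, Equiv.swap_apply_def, show Fin.castSucc (2 : Fin 3) = 2 from rfl] using
      key (h.swap 0 2)
  · obtain ⟨⟨-, ha1, ha2⟩, hc0, hc1, hc2⟩ := isDepthSolution_iff.1 h
    simpa [coeffX] using coeffX3_root (a0 := a 0) (d0 := d 0) ha1 ha2 hc0 hc1 hc2

/-- Relabelling of the first three points that fixes the `i`-th point and turns `Q_i` into a second
quadratic with the root `z_i²` which, for general data, is not proportional to `Q_i`.  For `i = 3`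
the transposition of `1` and `2` would not do: it turns `Q_3` into `-Q_3`. -/
def relabel (i : Fin 4) : Fin 3 × Fin 3 := ![(1, 2), (0, 2), (0, 1), (0, 1)] i

/-- The coefficients of the second quadratic with the root `z_i²`, obtained from `Q_i` by
exchanging two of the first three points. -/
def coeffY (a b c d : Fin 3 → R) (i : Fin 4) (j : Fin 3) : R :=
  let σ := Equiv.swap (relabel i).1 (relabel i).2
  coeffX (a ∘ σ) (b ∘ σ) (c ∘ σ) (d ∘ σ) i j

theorem IsDepthSolution.coeffY_root {a b c d : Fin 3 → R} {z : Fin 4 → R}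
    (h : IsDepthSolution a b c d z) (i : Fin 4) :
    coeffY a b c d i 2 * z i ^ 4 + coeffY a b c d i 1 * z i ^ 2 + coeffY a b c d i 0 = 0 := by
  have hz : z i = (z ∘ Equiv.swap (relabel i).1.castSucc (relabel i).2.castSucc) i := by
    rw [Function.comp_apply, Equiv.swap_apply_of_ne_of_ne] <;> revert i <;> decide
  rw [hz]
  exact (h.swap _ _).coeffX_root i

/-- The coefficient of `x` left after eliminating `x²` between `Q_i` and the second quadratic with
the root `z_i²`.  Where it does not vanish, the two quadratics have at most one common root. -/
def eliminant (a b c d : Fin 3 → R) (i : Fin 4) : R :=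
  coeffY a b c d i 2 * coeffX a b c d i 1 - coeffX a b c d i 2 * coeffY a b c d i 1

/-- The genericity invariant: it is nonzero if and only if, over a domain, all `Q_i` have degree
`2` and all four squared depths can be eliminated. -/
def genericity (a b c d : Fin 3 → R) : R :=
  ∏ i, coeffX a b c d i 2 * eliminant a b c d i

theorem map_coeffY (φ : R →+* S) (a b c d : Fin 3 → R) (i : Fin 4) (j : Fin 3) :
    φ (coeffY a b c d i j) = coeffY (φ ∘ a) (φ ∘ b) (φ ∘ c) (φ ∘ d) i j :=
  map_coeffX ..

theorem map_eliminant (φ : R →+* S) (a b c d : Fin 3 → R) (i : Fin 4) :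
    φ (eliminant a b c d i) = eliminant (φ ∘ a) (φ ∘ b) (φ ∘ c) (φ ∘ d) i := by
  simp only [eliminant, map_sub, map_mul, map_coeffX, map_coeffY]

theorem map_genericity (φ : R →+* S) (a b c d : Fin 3 → R) :
    φ (genericity a b c d) = genericity (φ ∘ a) (φ ∘ b) (φ ∘ c) (φ ∘ d) := by
  simp only [genericity, map_prod, map_mul, map_coeffX, map_eliminant]

theorem IsDepthSolution.map {a b c d : Fin 3 → R} {z : Fin 4 → R} (φ : R →+* S)
    (h : IsDepthSolution a b c d z) :
    IsDepthSolution (φ ∘ a) (φ ∘ b) (φ ∘ c) (φ ∘ d) (φ ∘ z) :=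
  ⟨fun i => by simp [h.1 i, map_ofNat], fun i => by simp [h.2 i, map_ofNat]⟩

theorem IsDepthSolution.sq_eq_sq [IsDomain R] {a b c d : Fin 3 → R} {z w : Fin 4 → R} {i : Fin 4}
    (hz : IsDepthSolution a b c d z) (hw : IsDepthSolution a b c d w)
    (h : eliminant a b c d i ≠ 0) : w i ^ 2 = z i ^ 2 := by
  refine mul_left_cancel₀ h ?_
  simp only [eliminant]
  linear_combination coeffY a b c d i 2 * (hw.coeffX_root i - hz.coeffX_root i)
    - coeffX a b c d i 2 * (hw.coeffY_root i - hz.coeffY_root i)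

/-- Where the eliminants do not vanish, the six equations determine the depths up to a common
sign. -/
theorem IsDepthSolution.eq_or_eq_neg [IsDomain R] [NeZero (2 : R)] {a b c d : Fin 3 → R}
    {z w : Fin 4 → R} (hz : IsDepthSolution a b c d z) (hw : IsDepthSolution a b c d w)
    (h : ∀ i, eliminant a b c d i ≠ 0) (h3 : z 3 ≠ 0) : w = z ∨ w = -z := by
  have hsq i : w i ^ 2 = z i ^ 2 := hz.sq_eq_sq hw (h i)
  have hmul (i : Fin 3) : w i.castSucc * w 3 = z i.castSucc * z 3 := by
    refine mul_left_cancel₀ (NeZero.ne (2 : R)) ?_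
    linear_combination hsq 3 + b i * hsq i.castSucc + hw.2 i - hz.2 i
  rcases sq_eq_sq_iff_eq_or_eq_neg.1 (hsq 3) with h' | h'
  · refine Or.inl (funext (Fin.lastCases h' fun i => mul_right_cancel₀ h3 ?_))
    rw [← hmul i, h']
  · refine Or.inr (funext (Fin.lastCases h' fun i => mul_right_cancel₀ h3 ?_))
    rw [Pi.neg_apply, neg_mul, ← hmul i, h', mul_neg, neg_neg]

end Algebra

/-! ### Poses and the output of the algorithm -/

section Geometry

theorem norm_smul_sub_smul_sq {E : Type*} [NormedAddCommGroup E] [InnerProductSpace ℝ E]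
    (s t : ℝ) (u v : E) :
    ‖s • u - t • v‖ ^ 2
      = s ^ 2 * inner ℝ u u + t ^ 2 * inner ℝ v v - 2 * s * t * inner ℝ u v := by
  rw [norm_sub_sq_real, inner_smul_left, inner_smul_right, norm_smul, norm_smul, mul_pow, mul_pow,
    real_inner_self_eq_norm_sq, real_inner_self_eq_norm_sq, Real.norm_eq_abs, Real.norm_eq_abs,
    sq_abs, sq_abs, conj_trivial]
  ring

/-- The depths of a pose, rescaled as in the last step of the algorithm, solve the six equations:
these are the law of cosines in the triangles formed by the origin and two of the `T (P_i)`. -/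
theorem isDepthSolution_of_pose {P p : Fin 4 → Space} {T : Space ≃ᵃⁱ[ℝ] Space} {t : Fin 4 → ℝ}
    (hp : ∀ i, inner ℝ (p i) (p 3) ≠ 0) (hT : ∀ i, T (P i) = t i • p i) :
    IsDepthSolution (coordA P) (coordB p) (coordC P) (coordD p)
      (fun i => t i * inner ℝ (p i) (p 3) / ‖p 3‖) := by
  have hdist i j : ‖P i - P j‖ ^ 2 = t i ^ 2 * inner ℝ (p i) (p i) + t j ^ 2 * inner ℝ (p j) (p j)
      - 2 * t i * t j * inner ℝ (p i) (p j) := by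
    rw [← dist_eq_norm, ← T.dist_map, dist_eq_norm, hT, hT, norm_smul_sub_smul_sq]
  have h3 : ‖p 3‖ ≠ 0 := fun h => hp 3 (by simp [h])
  refine ⟨fun i => ?_, fun i => ?_⟩
  · have hj := hp (i + 1).castSucc
    have hk := hp (i + 2).castSucc
    simp only [coordA, coordB, coordD, hdist, real_inner_self_eq_norm_sq (p 3)]
    field_simp
  · have hi := hp i.castSucc
    simp only [coordC, coordB, hdist, real_inner_self_eq_norm_sq (p 3)]
    field_simp
    ring

theorem residual_eq_zero_iff {P p : Fin 4 → Space} {z : Fin 4 → ℂ} :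
    residual P p z = 0 ↔ IsDepthSolution (fun i => (coordA P i : ℂ)) (fun i => (coordB p i : ℂ))
      (fun i => (coordC P i : ℂ)) (fun i => (coordD p i : ℂ)) z := by
  simp only [residual, IsDepthSolution, funext_iff, Sum.forall, Sum.elim_inl, Sum.elim_inr,
    Pi.zero_apply, sub_eq_zero]

theorem quadQ_isRoot_iff {P p : Fin 4 → Space} {i : Fin 4} {x : ℂ} :
    (quadQ P p i).IsRoot x ↔
      ((coeffX (coordA P) (coordB p) (coordC P) (coordD p) i 2 : ℝ) : ℂ) * x ^ 2
        + ((coeffX (coordA P) (coordB p) (coordC P) (coordD p) i 1 : ℝ) : ℂ) * x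
        + ((coeffX (coordA P) (coordB p) (coordC P) (coordD p) i 0 : ℝ) : ℂ) = 0 := by
  simp [quadQ, Polynomial.IsRoot]

theorem re_sqrt_nonneg (x : ℂ) : 0 ≤ x.sqrt.re := by
  rw [Complex.sqrt, Complex.cpow_inv_two_re]
  exact Real.sqrt_nonneg _

theorem sqrt_ofReal_sq (x : ℝ) : ((x : ℂ) ^ 2).sqrt = (|x| : ℝ) := by
  rw [← Complex.ofReal_pow, Complex.sqrt_of_nonneg (by exact_mod_cast sq_nonneg x),
    Complex.ofReal_re, Real.sqrt_sq_eq_abs]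

/-- For data at which the genericity invariant does not vanish, the depths of any pose are the
only possible output. -/
theorem isOutput_iff_of_pose {P p : Fin 4 → Space} {T : Space ≃ᵃⁱ[ℝ] Space} {t : Fin 4 → ℝ}
    (hp : ∀ i, inner ℝ (p i) (p 3) ≠ 0) (ht : ∀ i, 0 < t i) (hT : ∀ i, T (P i) = t i • p i)
    (hgen : genericity (coordA P) (coordB p) (coordC P) (coordD p) ≠ 0)
    {err : (Fin 3 ⊕ Fin 3 → ℂ) → ℝ} (herr : IsErrorMeasure err) (ζ : Fin 4 → ℂ) :
    IsOutput err P p ζ ↔ ∀ i, ζ i = (t i : ℂ) := by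
  have hgen' := fun i => mul_ne_zero_iff.1 (Finset.prod_ne_zero_iff.1 hgen i (Finset.mem_univ i))
  have h3 : 0 < ‖p 3‖ := norm_pos_iff.2 fun h => hp 3 (by simp [h])
  have h33 : 0 < inner ℝ (p 3) (p 3) := by rw [real_inner_self_eq_norm_sq]; positivity
  set Z : Fin 4 → ℝ := fun i => t i * inner ℝ (p i) (p 3) / ‖p 3‖ with hZ
  have hsol : IsDepthSolution _ _ _ _ Z := isDepthSolution_of_pose hp hT
  have hsolC := hsol.map Complex.ofRealHom
  have hZ3 : 0 < Z 3 := div_pos (mul_pos (ht 3) h33) h3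
  -- the sign rule of the algorithm picks the correct square root of `Z_i²`
  have hcand : candidate p (fun i => (Z i : ℂ) ^ 2) = fun i => (Z i : ℂ) := by
    funext i
    simp only [candidate, sqrt_ofReal_sq]
    split_ifs with h
    · rw [abs_of_nonneg (div_nonneg (mul_nonneg (ht i).le h.le) h3.le)]
    · rw [abs_of_nonpos (div_nonpos_of_nonpos_of_nonneg
        (mul_nonpos_of_nonneg_of_nonpos (ht i).le (not_lt.1 h)) h3.le)]
      rw [Complex.ofReal_neg, neg_neg]
  have hres : residual P p (candidate p fun i => (Z i : ℂ) ^ 2) = 0 := by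
    rw [hcand]; exact residual_eq_zero_iff.2 hsolC
  have hroot i : (quadQ P p i).IsRoot ((Z i : ℂ) ^ 2) := by
    rw [quadQ_isRoot_iff]
    have := hsol.coeffX_root i
    rw [← pow_mul]
    exact_mod_cast this
  have hscale i : ((‖p 3‖ / inner ℝ (p i) (p 3) : ℝ) : ℂ) * (Z i : ℂ) = t i := by
    rw [← Complex.ofReal_mul, hZ]
    congr 1
    have := hp i
    field_simp
  constructor
  · rintro ⟨-, α, -, hmin, hζ⟩ i
    have hα : residual P p (candidate p α) = 0 := by
      by_contra h
      have := hmin _ hroot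
      rw [hres, herr.zero] at this
      exact (herr.pos _ h).not_ge this
    have h3' : (Complex.ofRealHom ∘ Z) 3 ≠ 0 := by simpa using hZ3.ne'
    have helim i : eliminant (Complex.ofRealHom ∘ coordA P) (Complex.ofRealHom ∘ coordB p)
        (Complex.ofRealHom ∘ coordC P) (Complex.ofRealHom ∘ coordD p) i ≠ 0 := by
      rw [← map_eliminant]
      exact Complex.ofReal_ne_zero.2 (hgen' i).2
    have heq : candidate p α = Complex.ofRealHom ∘ Z := by
      refine (hsolC.eq_or_eq_neg (residual_eq_zero_iff.1 hα) helim h3').resolve_right fun h => ?_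
      have hre := congrArg Complex.re (congrFun h 3)
      have := re_sqrt_nonneg (α 3)
      simp only [candidate, if_pos h33, Pi.neg_apply, Function.comp_apply,
        Complex.ofRealHom_eq_coe, Complex.neg_re, Complex.ofReal_re] at hre
      linarith
    rw [hζ, heq, ← hscale i]
    rfl
  · intro h
    refine ⟨fun i => Polynomial.natDegree_quadratic (Complex.ofReal_ne_zero.2 (hgen' i).1),
      fun i => (Z i : ℂ) ^ 2, hroot, fun β _ => ?_, fun i => ?_⟩
    · rw [hres, herr.zero]
      by_cases hβ : residual P p (candidate p β) = 0
      · rw [hβ, herr.zero]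
      · exact (herr.pos _ hβ).le
    · rw [hcand, h, hscale]

end Geometry

/-! ### The genericity invariant as a polynomial condition -/

section Density

open Filter Topology

/-- The ring of functions on configurations that agree, wherever no `p_i` is orthogonal to `p_3`,
with a quotient of two polynomials in the coordinates whose denominator does not vanish there. -/
def regularFunctions : Subring ((Fin 4 → Space) × (Fin 4 → Space) → ℝ) where
  carrier := {f | ∃ N D : MvPolynomial (Fin 4 × Fin 3 ⊕ Fin 4 × Fin 3) ℝ,
    ∀ x, (∀ i, inner ℝ (x.2 i) (x.2 3) ≠ 0) →
      evalConfig D x ≠ 0 ∧ evalConfig N x = evalConfig D x * f x}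
  zero_mem' := ⟨0, 1, fun x _ => by simp [evalConfig]⟩
  one_mem' := ⟨1, 1, fun x _ => by simp [evalConfig]⟩
  add_mem' := by
    rintro f g ⟨N, D, h⟩ ⟨N', D', h'⟩
    refine ⟨N * D' + N' * D, D * D', fun x hx => ?_⟩
    obtain ⟨h1, h2⟩ := h x hx
    obtain ⟨h1', h2'⟩ := h' x hx
    simp only [evalConfig, map_add, map_mul, Pi.add_apply] at *
    exact ⟨mul_ne_zero h1 h1', by rw [h2, h2']; ring⟩
  mul_mem' := by
    rintro f g ⟨N, D, h⟩ ⟨N', D', h'⟩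
    refine ⟨N * N', D * D', fun x hx => ?_⟩
    obtain ⟨h1, h2⟩ := h x hx
    obtain ⟨h1', h2'⟩ := h' x hx
    simp only [evalConfig, map_mul, Pi.mul_apply] at *
    exact ⟨mul_ne_zero h1 h1', by rw [h2, h2']; ring⟩
  neg_mem' := by
    rintro f ⟨N, D, h⟩
    refine ⟨-N, D, fun x hx => ⟨(h x hx).1, ?_⟩⟩
    have := (h x hx).2
    simp only [evalConfig, map_neg, Pi.neg_apply] at *
    rw [this, mul_neg]

/-- The polynomial `p_i · p_j`. -/
noncomputable def innerPoly (i j : Fin 4) : MvPolynomial (Fin 4 × Fin 3 ⊕ Fin 4 × Fin 3) ℝ :=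
  ∑ m, MvPolynomial.X (Sum.inr (i, m)) * MvPolynomial.X (Sum.inr (j, m))

theorem evalConfig_innerPoly (i j : Fin 4) (x : (Fin 4 → Space) × (Fin 4 → Space)) :
    evalConfig (innerPoly i j) x = inner ℝ (x.2 i) (x.2 j) := by
  simp [evalConfig, innerPoly, PiLp.inner_apply, mul_comm]

/-- The polynomial `‖P_i - P_j‖²`. -/
noncomputable def distSqPoly (i j : Fin 4) : MvPolynomial (Fin 4 × Fin 3 ⊕ Fin 4 × Fin 3) ℝ :=
  ∑ m, (MvPolynomial.X (Sum.inl (i, m)) - MvPolynomial.X (Sum.inl (j, m))) ^ 2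

theorem evalConfig_distSqPoly (i j : Fin 4) (x : (Fin 4 → Space) × (Fin 4 → Space)) :
    evalConfig (distSqPoly i j) x = ‖x.1 i - x.1 j‖ ^ 2 := by
  simp [evalConfig, distSqPoly, EuclideanSpace.real_norm_sq_eq]

/-- Wherever no `p_i` is orthogonal to `p_3`, the vanishing of the genericity invariant is a
polynomial condition. -/
theorem exists_polynomial_genericity :
    ∃ F : MvPolynomial (Fin 4 × Fin 3 ⊕ Fin 4 × Fin 3) ℝ,
      ∀ P p : Fin 4 → Space, (∀ i, inner ℝ (p i) (p 3) ≠ 0) →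
        (evalConfig F (P, p) ≠ 0 ↔
          genericity (coordA P) (coordB p) (coordC P) (coordD p) ≠ 0) := by
  let A : Fin 3 → regularFunctions := fun i => ⟨fun x => coordA x.1 i,
    distSqPoly (i + 1).castSucc (i + 2).castSucc, 1, fun x _ => by
      rw [evalConfig_distSqPoly]; simp [evalConfig, coordA]⟩
  let B : Fin 3 → regularFunctions := fun i => ⟨fun x => coordB x.2 i,
    innerPoly i.castSucc i.castSucc * innerPoly 3 3, innerPoly i.castSucc 3 ^ 2, fun x hx => by
      have h := hx i.castSucc
      have hm : ∀ F G, evalConfig (F * G) x = evalConfig F x * evalConfig G x :=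
        map_mul (MvPolynomial.eval _)
      simp only [sq, hm, evalConfig_innerPoly, coordB]
      exact ⟨mul_ne_zero h h, by field_simp⟩⟩
  let C : Fin 3 → regularFunctions := fun i => ⟨fun x => coordC x.1 i,
    distSqPoly i.castSucc 3, 1, fun x _ => by
      rw [evalConfig_distSqPoly]; simp [evalConfig, coordC]⟩
  let D : Fin 3 → regularFunctions := fun i => ⟨fun x => coordD x.2 i,
    innerPoly (i + 1).castSucc (i + 2).castSucc * innerPoly 3 3,
    innerPoly (i + 1).castSucc 3 * innerPoly (i + 2).castSucc 3, fun x hx => by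
      have h := hx (i + 1).castSucc
      have h' := hx (i + 2).castSucc
      have hm : ∀ F G, evalConfig (F * G) x = evalConfig F x * evalConfig G x :=
        map_mul (MvPolynomial.eval _)
      simp only [hm, evalConfig_innerPoly, coordD]
      exact ⟨mul_ne_zero h h', by field_simp⟩⟩
  obtain ⟨N, G, h⟩ := (genericity A B C D).2
  refine ⟨N, fun P p hp => ?_⟩
  obtain ⟨h1, h2⟩ := h (P, p) hp
  have hval : (genericity A B C D).1 (P, p)
      = genericity (coordA P) (coordB p) (coordC P) (coordD p) :=
    map_genericity ((Pi.evalRingHom _ (P, p)).comp regularFunctions.subtype) A B C D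
  rw [h2, hval, mul_ne_zero_iff, and_iff_right h1]

/-! ### Density of the generic configurations -/

/-- Canvas points of a configuration at which the genericity invariant does not vanish. -/
noncomputable def witnessCanvas : Fin 4 → Space :=
  ![!₂[-1, -1, 1], !₂[-1, 0, 1], !₂[-1, 1, 1], !₂[0, 0, 1]]

/-- Depths of a configuration at which the genericity invariant does not vanish. -/
def witnessDepth : Fin 4 → ℝ := ![1, 2, 3, 1]

theorem genericity_witness_ne_zero :
    genericity (R := ℤ) ![11, 24, 3] ![3, 2, 3] ![2, 5, 22] ![2, 1, 2] ≠ 0 := by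
  decide +kernel

/-- The integers `11, 24, 3; 3, 2, 3; 2, 5, 22; 2, 1, 2` are the `a, b, c, d` of the witness. -/
theorem genericity_witnessCanvas_ne_zero (T : Space ≃ᵃⁱ[ℝ] Space) :
    genericity (coordA fun i => T.symm (witnessDepth i • witnessCanvas i)) (coordB witnessCanvas)
      (coordC fun i => T.symm (witnessDepth i • witnessCanvas i)) (coordD witnessCanvas) ≠ 0 := by
  have hdist (x y : Space) : ‖T.symm x - T.symm y‖ ^ 2 = ‖x - y‖ ^ 2 := by
    rw [← dist_eq_norm, T.symm.dist_map, dist_eq_norm]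
  have hnum := (map_ne_zero_iff (Int.castRingHom ℝ) Int.cast_injective).2
    genericity_witness_ne_zero
  rw [map_genericity] at hnum
  convert hnum using 2 <;> ext i <;> fin_cases i <;>
    simp [coordA, coordB, coordC, coordD, hdist, witnessDepth, witnessCanvas,
      EuclideanSpace.real_norm_sq_eq, PiLp.inner_apply, Fin.sum_univ_three,
      show (1 : Fin 3) + 2 = 0 from rfl, show (2 : Fin 3) + 2 = 1 from rfl,
      show (1 : Fin 3) + 1 = 2 from rfl, show (2 : Fin 3) + 1 = 0 from rfl,
      show Fin.castSucc (2 : Fin 3) = 2 from rfl] <;> norm_num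

theorem inner_witnessCanvas_ne_zero (i : Fin 4) :
    inner ℝ (witnessCanvas i) (witnessCanvas 3) ≠ 0 := by
  fin_cases i <;> simp [witnessCanvas, PiLp.inner_apply, Fin.sum_univ_three]

/-- The canvas points `p`, moved along the segment towards those of the witness. -/
noncomputable def canvasPath (p : Fin 4 → Space) (s : ℝ) (i : Fin 4) : Space :=
  p i + s • (witnessCanvas i - p i)

/-- The depths `t`, moved along the segment towards those of the witness. -/
def depthPath (t : Fin 4 → ℝ) (s : ℝ) (i : Fin 4) : ℝ :=
  t i + s * (witnessDepth i - t i)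

/-- The path of configurations with the fixed pose `T`, the canvas points `canvasPath p` and the
depths `depthPath t`. -/
noncomputable def configPath (T : Space ≃ᵃⁱ[ℝ] Space) (p : Fin 4 → Space) (t : Fin 4 → ℝ) (s : ℝ) :
    (Fin 4 → Space) × (Fin 4 → Space) :=
  (fun i => T.symm (depthPath t s i • canvasPath p s i), canvasPath p s)

theorem continuous_canvasPath (p : Fin 4 → Space) : Continuous (canvasPath p) := by
  unfold canvasPath
  fun_prop

theorem continuous_configPath (T : Space ≃ᵃⁱ[ℝ] Space) (p : Fin 4 → Space) (t : Fin 4 → ℝ) :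
    Continuous (configPath T p t) := by
  refine Continuous.prodMk (continuous_pi fun i => T.symm.continuous.comp ?_)
    (continuous_canvasPath p)
  unfold depthPath canvasPath
  fun_prop

/-- Since an isometry is affine, a polynomial in the coordinates is polynomial along
`configPath`. -/
theorem exists_polynomial_configPath (T : Space ≃ᵃⁱ[ℝ] Space) (p : Fin 4 → Space) (t : Fin 4 → ℝ)
    (F : MvPolynomial (Fin 4 × Fin 3 ⊕ Fin 4 × Fin 3) ℝ) :
    ∃ q : Polynomial ℝ, ∀ s, q.eval s = evalConfig F (configPath T p t s) := by
  have hT (v : Space) : T.symm v = T.symm.linearIsometryEquiv v + T.symm 0 := by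
    simpa using (T.symm.map_vadd 0 v)
  let v (i : Fin 4) : Space := witnessCanvas i - p i
  let δ (i : Fin 4) : ℝ := witnessDepth i - t i
  let L := T.symm.linearIsometryEquiv
  let q : Fin 4 × Fin 3 ⊕ Fin 4 × Fin 3 → Polynomial ℝ := Sum.elim
    (fun m => (.C (t m.1) + .X * .C (δ m.1)) * (.C (L (p m.1) m.2) + .X * .C (L (v m.1) m.2))
      + .C (T.symm 0 m.2))
    (fun m => .C (p m.1 m.2) + .X * .C (v m.1 m.2))
  refine ⟨MvPolynomial.aeval q F, fun s => ?_⟩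
  rw [← Polynomial.coe_evalRingHom, MvPolynomial.aeval_def, MvPolynomial.hom_eval₂, evalConfig,
    MvPolynomial.eval, MvPolynomial.coe_eval₂Hom]
  congr 1
  · ext; simp
  · funext m
    rcases m with ⟨i, m⟩ | ⟨i, m⟩
    · change _ = T.symm (depthPath t s i • canvasPath p s i) m
      rw [hT]
      simp [q, depthPath, canvasPath, L, v, δ]
      ring
    · simp [q, configPath, canvasPath, v]

theorem perspectiveSet_subset_closure {F : MvPolynomial (Fin 4 × Fin 3 ⊕ Fin 4 × Fin 3) ℝ}
    (hF : ∀ P p : Fin 4 → Space, (∀ i, inner ℝ (p i) (p 3) ≠ 0) →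
        (evalConfig F (P, p) ≠ 0 ↔
          genericity (coordA P) (coordB p) (coordC P) (coordD p) ≠ 0)) :
    perspectiveSet ⊆ closure {x ∈ perspectiveSet | evalConfig F x ≠ 0} := by
  rintro ⟨P, p⟩ ⟨hz, hp, T, hT⟩
  choose hT0 t ht hTt using hT
  have htpos i : 0 < t i :=
    (ht i).lt_of_ne fun h => hT0 i (by rw [hTt, ← h, zero_smul])
  have h0 : configPath T p t 0 = (P, p) := by
    simp [configPath, depthPath, canvasPath, ← hTt, funext_iff]
  have hlim : Tendsto (configPath T p t) (𝓝[>] 0) (𝓝 (P, p)) := by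
    rw [← h0]
    exact ((continuous_configPath T p t).tendsto 0).mono_left nhdsWithin_le_nhds
  refine mem_closure_of_tendsto hlim ?_
  have hF' : ∀ᶠ s in 𝓝[>] (0 : ℝ), evalConfig F (configPath T p t s) ≠ 0 := by
    obtain ⟨q, hq⟩ := exists_polynomial_configPath T p t F
    have h1 : configPath T p t 1
        = (fun i => T.symm (witnessDepth i • witnessCanvas i), witnessCanvas) := by
      have hc : canvasPath p 1 = witnessCanvas := by ext; simp [canvasPath]
      simp [configPath, depthPath, hc]
    have hq0 : q ≠ 0 := by
      rintro rfl
      have := hq 1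
      rw [Polynomial.eval_zero, h1] at this
      exact (hF _ _ inner_witnessCanvas_ne_zero).2 (genericity_witnessCanvas_ne_zero T) this.symm
    have hfin : {s | q.IsRoot s}.Finite := Polynomial.finite_setOfPred_isRoot hq0
    have hle : 𝓝[>] (0 : ℝ) ≤ cofinite :=
      (nhdsWithin_mono (0 : ℝ) fun s (hs : 0 < s) => hs.ne').trans (nhdsNE_le_cofinite 0)
    filter_upwards [hle hfin.compl_mem_cofinite] with s hs
    rw [← hq]
    exact hs
  have hp' : ∀ᶠ s in 𝓝[>] (0 : ℝ), ∀ i, inner ℝ (canvasPath p s i) (canvasPath p s 3) ≠ 0 := by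
    refine nhdsWithin_le_nhds (eventually_all.2 fun i => ?_)
    have hcont : Continuous fun s => inner ℝ (canvasPath p s i) (canvasPath p s 3) :=
      ((continuous_apply i).comp (continuous_canvasPath p)).inner
        ((continuous_apply 3).comp (continuous_canvasPath p))
    exact hcont.continuousAt.eventually_ne (by simpa [canvasPath] using hp i)
  filter_upwards [hF', hp', Ioo_mem_nhdsGT one_pos] with s hs hps hs01
  have hcanvas i : canvasPath p s i 2 = 1 := by
    have : witnessCanvas i 2 = 1 := by fin_cases i <;> simp [witnessCanvas]
    have hz' : p i 2 = 1 := hz i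
    simp [canvasPath, hz', this]
  have hdepth i : 0 < depthPath t s i := by
    have : 0 < witnessDepth i := by fin_cases i <;> simp [witnessDepth]
    have h1 := mul_pos hs01.1 this
    have h2 := mul_pos (sub_pos.2 hs01.2) (htpos i)
    rw [depthPath]
    linarith
  refine ⟨⟨hcanvas, hps, T, fun i =>
    ⟨?_, depthPath t s i, (hdepth i).le, by simp [configPath]⟩⟩, hs⟩
  have : canvasPath p s i ≠ 0 := fun h => by simpa [h] using hcanvas i
  simpa [configPath] using smul_ne_zero (hdepth i).ne' this

end Density

end FourPoint

theorem mainTheorem2 :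
    ∃ F : MvPolynomial (Fin 4 × Fin 3 ⊕ Fin 4 × Fin 3) ℝ,
      -- the locus `F ≠ 0` is dense in the set of perspective configurations
      FourPoint.perspectiveSet ⊆
        closure {x ∈ FourPoint.perspectiveSet | FourPoint.evalConfig F x ≠ 0} ∧
      ∀ P p : Fin 4 → FourPoint.Space, FourPoint.evalConfig F (P, p) ≠ 0 →
        (∀ i, p i 2 = 1) → (∀ i, inner ℝ (p i) (p 3) ≠ 0) →
        ∀ T : FourPoint.Space ≃ᵃⁱ[ℝ] FourPoint.Space, FourPoint.IsPose P p T →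
        ∀ err : (Fin 3 ⊕ Fin 3 → ℂ) → ℝ, FourPoint.IsErrorMeasure err →
          ∃ z : Fin 4 → ℝ, (∀ i, 0 < z i ∧ T (P i) = z i • p i) ∧
            ∀ ζ : Fin 4 → ℂ, FourPoint.IsOutput err P p ζ ↔ ∀ i, ζ i = (z i : ℂ) := by
  obtain ⟨F, hF⟩ := FourPoint.exists_polynomial_genericity
  refine ⟨F, FourPoint.perspectiveSet_subset_closure hF, fun P p hFP _ hp T hT err herr => ?_⟩
  choose hT0 t ht hTt using hT
  have htpos i : 0 < t i :=
    (ht i).lt_of_ne fun h => hT0 i (by rw [hTt, ← h, zero_smul])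
  exact ⟨t, fun i => ⟨htpos i, hTt i⟩,
    FourPoint.isOutput_iff_of_pose hp htpos hTt ((hF P p hp).1 hFP) herr⟩
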